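/- Let $S^1=\mathbb{R}/\mathbb{Z}$ with Lebesgue probability measure $\mathrm{Leb}$, let $T_u(x)=x+u$, and let $v=\theta \bmod 1$ with $\theta$ irrational. Let $A\subset S^1$ be a Borel set, and let $\varphi_A(\varepsilon)=\mathrm{Leb}(A\,\triangle\,T_\varepsilon(A))$ be its displacement function. Assume that $A$ has no translational symmetries, i.e. $\varphi_A(\varepsilon)=0$ if and only if $\varepsilon=0$, and that $\int_{S^1}\frac{d\varepsilon}{\varphi_A(\varepsilon)}<+\infty$. Let $f(x)=x+v$ for $x\in A$ and $f(x)=x$ for $x\notin A$; put $f_u=T_u\circ f$, and for a sequence $w=(w_i)_{i\ge1}$ in $\Omega=(S^1)^{\mathbb{N}}$, equipped with the product measure $\mathrm{Leb}^{\mathbb{N}}$, put $F_w^n=f_{w_n}\circ\dots\circ f_{w_1}$. Then, with $Z=\int_{S^1}\frac{dx}{\varphi_A(x)}$, the measure $\overline\mu=\frac1Z\cdot\frac{dx}{\varphi_A(x)}$ is a probability measure on $S^1$ (not depending on $w$) with $\overline\mu(\{0\})=0$, and for Lebesgue-almost every pair $(x,y)\in S^1\times S^1$ and almost every $w\in\Omega$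 one has the weak convergence of measures $$\frac1N\sum_{n=1}^N\delta_{F_w^n(x)-F_w^n(y)}\to\overline\mu\qquad (N\to\infty).$$ In particular, there is no synchronization: for Lebesgue-almost every pair $(x,y)$ and almost every $w$, it is not true that for all $\delta>0$ $$\frac1N\#\{n\in\{1,\dots,N\} : \mathrm{dist}(F_w^n(x),F_w^n(y))<\delta\}\to1\qquad (N\to\infty).$$ -/

import Mathlib

open MeasureTheory Filter Topology
open scoped ENNReal NNReal symmDiff

noncomputable section

namespace DoubleRotation

/-- The circle `S¹ = ℝ/ℤ`; its `volume` is the Lebesgue probability measure and its distance is the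
arc-length distance. -/
abbrev Circ : Type := UnitAddCircle

instance isProbabilityMeasure_volume : IsProbabilityMeasure (volume : Measure Circ) :=
  ⟨UnitAddCircle.measure_univ⟩

/-- The translation `T_u(x) = x + u`. -/
def translation (u x : Circ) : Circ := x + u

/-- The displacement function `φ_A(ε) = Leb (A ∆ T_ε(A))`. -/
def displacement (A : Set Circ) (ε : Circ) : ℝ :=
  (volume : Measure Circ).real (A ∆ (translation ε '' A))

/-- `A` has no translational symmetries: `φ_A(ε) = 0` if and only if `ε = 0`. -/
def NoTranslationalSymmetries (A : Set Circ) : Prop :=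
  ∀ ε : Circ, displacement A ε = 0 ↔ ε = 0

/-- The function `1 / φ_A` with values in `[0, ∞]` (infinite where `φ_A` vanishes). -/
def invDisplacement (A : Set Circ) (x : Circ) : ℝ≥0∞ :=
  (ENNReal.ofReal (displacement A x))⁻¹

/-- `Z = ∫ dx / φ_A(x)`. -/
def normalizer (A : Set Circ) : ℝ≥0∞ :=
  ∫⁻ x : Circ, invDisplacement A x

/-- The measure `(1 / Z) dx / φ_A(x)`. -/
def limitMeasure (A : Set Circ) : Measure Circ :=
  (normalizer A)⁻¹ • (volume : Measure Circ).withDensity (invDisplacement A)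

open Classical in
/-- The map which translates the points of `A` by `v` and fixes the other points. -/
def doubleRotation (A : Set Circ) (v x : Circ) : Circ :=
  if x ∈ A then x + v else x

/-- `F_w^n = f_{w_n} ∘ ⋯ ∘ f_{w_1}` with `f_u = T_u ∘ f`, where `f` is the double rotation and the
`i`-th shift `w_i` (for `i = 1, 2, …`) is stored as `w (i - 1)`. -/
def randomIterate (A : Set Circ) (v : Circ) (w : ℕ → Circ) : ℕ → Circ → Circ
  | 0, x => x
  | n + 1, x => translation (w n) (doubleRotation A v (randomIterate A v w n x))

/-- The product measure `Leb^ℕ` on the space `Ω = (S¹)^ℕ` of sequences of shifts. -/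
def shiftMeasure : Measure (ℕ → Circ) :=
  Measure.infinitePi fun _ : ℕ => (volume : Measure Circ)

/-- The Dirac measure `δ_a`. -/
def diracMeasure (a : Circ) : FiniteMeasure Circ :=
  ⟨Measure.dirac a, inferInstance⟩

/-- The empirical distribution `(1 / N) ∑_{n = 1}^N δ_{z n}` (the zero measure for `N = 0`), as an
element of the space of finite measures with the topology of weak convergence. -/
def empiricalMeasure (z : ℕ → Circ) (N : ℕ) : FiniteMeasure Circ :=
  (N : ℝ≥0)⁻¹ • ∑ n ∈ Finset.Icc 1 N, diracMeasure (z n)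

/-- The two sequences of points synchronize: for each `δ > 0` the proportion of the times
`n ∈ {1, …, N}` at which their distance is less than `δ` tends to `1`. -/
def Synchronizes (x y : ℕ → Circ) : Prop :=
  ∀ δ : ℝ, 0 < δ →
    Tendsto (fun N : ℕ => (({n : ℕ | 1 ≤ n ∧ n ≤ N ∧ dist (x n) (y n) < δ}.ncard : ℝ) / (N : ℝ)))
      atTop (𝓝 1)

end DoubleRotation

end

/-! Follow the pair (first point, difference `d`). The common uniform shift makes the first point
uniform and independent of the new difference, so the differences form a Markov chain: `d` moves to
`d + v` or `d - v` with probability `φ_A(d) / 2` each and otherwise stays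
(`lintegral_comp_difference`). The density `1 / φ_A` makes the flow along each edge equal to `1 /
2`, hence it is stationary (`lintegral_invDisplacement_mul_transition`). A bounded harmonic function
of this chain satisfies the midpoint relation along orbits of the rotation by `v`, so it is affine
and bounded there, hence invariant under the rotation, hence a.e. constant
(`ae_eq_const_of_harmonic`). A zero-one law turns this into ergodicity of the skew product over the
shift (`ergodic_skewProduct`, `ergodic_pairStep`), and Birkhoff's theorem gives the limit. As `1 /
φ_A ≥ 1`, almost every pair for the stationary law means Lebesgue-almost every pair. Synchronization
would put all the limit mass at `0`, which has measure zero. -/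

namespace DoubleRotation

/-! ### Birkhoff's pointwise ergodic theorem -/

section PointwiseErgodic

variable {α : Type*} {T : α → α} {g : α → ℝ}

/-- The maximum of `0` and the first `n` Birkhoff sums of `g`. -/
def maxBirkhoff (T : α → α) (g : α → ℝ) : ℕ → α → ℝ
  | 0, _ => 0
  | n + 1, x => max 0 (g x + maxBirkhoff T g n (T x))

theorem maxBirkhoff_nonneg (n : ℕ) (x : α) : 0 ≤ maxBirkhoff T g n x := by
  cases n with
  | zero => exact le_rfl
  | succ n => exact le_max_left _ _

theorem maxBirkhoff_le_succ (n : ℕ) (x : α) :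
    maxBirkhoff T g n x ≤ maxBirkhoff T g (n + 1) x := by
  induction n generalizing x with
  | zero => exact le_max_left _ _
  | succ n ih => exact max_le_max le_rfl (by gcongr; exact ih _)

theorem birkhoffSum_le_maxBirkhoff (n : ℕ) (x : α) :
    birkhoffSum T g n x ≤ maxBirkhoff T g n x := by
  induction n generalizing x with
  | zero => simp [maxBirkhoff]
  | succ n ih =>
    rw [birkhoffSum_succ']
    exact le_max_of_le_right (by gcongr; exact ih _)

theorem bddAbove_birkhoffSum_comp (x : α) :
    BddAbove (Set.range fun n => birkhoffSum T g n (T x)) ↔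
      BddAbove (Set.range fun n => birkhoffSum T g n x) := by
  constructor
  · rintro ⟨B, hB⟩
    refine ⟨max 0 (g x + B), ?_⟩
    rintro _ ⟨n, rfl⟩
    cases n with
    | zero => simp
    | succ n =>
      dsimp only
      rw [birkhoffSum_succ']
      exact le_max_of_le_right (by gcongr; exact hB ⟨n, rfl⟩)
  · rintro ⟨B, hB⟩
    refine ⟨B - g x, ?_⟩
    rintro _ ⟨n, rfl⟩
    have := hB ⟨n + 1, rfl⟩
    dsimp only at this ⊢
    rw [birkhoffSum_succ'] at this
    linarith

variable [MeasurableSpace α] {μ : Measure α}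

theorem integrable_maxBirkhoff (hT : MeasurePreserving T μ μ) (hg : Integrable g μ) (n : ℕ) :
    Integrable (maxBirkhoff T g n) μ := by
  induction n with
  | zero => exact integrable_zero α ℝ μ
  | succ n ih =>
    exact (integrable_zero α ℝ μ).sup (hg.add (hT.integrable_comp_of_integrable ih))

theorem measurable_birkhoffSum (hT : Measurable T) (hg : Measurable g) (n : ℕ) :
    Measurable (birkhoffSum T g n) := by
  unfold birkhoffSum
  exact Finset.measurable_sum _ fun i _ => hg.comp (hT.iterate i)

/-- The set where the sums are bounded above is invariant, so it is full or null. If it is null,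
`M_{n+1} - M_n ∘ T = max (-M_n ∘ T) g` tends to `g` a.e., while its integral is nonnegative because
`M_n` increases and `T` preserves `μ`; this contradicts `∫ g < 0`. -/
theorem ae_bddAbove_birkhoffSum (hT : Ergodic T μ) (hgm : Measurable g)
    (hg : Integrable g μ) (hneg : ∫ x, g x ∂μ < 0) :
    ∀ᵐ x ∂μ, BddAbove (Set.range fun n => birkhoffSum T g n x) := by
  have hmp := hT.toMeasurePreserving
  set E : Set α := {x | BddAbove (Set.range fun n => birkhoffSum T g n x)} with hE
  have hEm : MeasurableSet E := by
    have : E = ⋃ k : ℕ, ⋂ n, {x | birkhoffSum T g n x ≤ k} := by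
      ext x
      simp only [hE, Set.mem_ofPred_eq, Set.mem_iUnion, Set.mem_iInter]
      constructor
      · rintro ⟨B, hB⟩
        obtain ⟨k, hk⟩ := exists_nat_ge B
        exact ⟨k, fun n => (hB ⟨n, rfl⟩).trans hk⟩
      · rintro ⟨k, hk⟩
        exact ⟨k, by rintro _ ⟨n, rfl⟩; exact hk n⟩
    rw [this]
    exact .iUnion fun k => .iInter fun n =>
      measurableSet_le (measurable_birkhoffSum hmp.measurable hgm n) measurable_const
  have hinv : T ⁻¹' E = E := by
    ext x
    exact bddAbove_birkhoffSum_comp x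
  rcases hT.toPreErgodic.ae_mem_or_ae_notMem hEm hinv with h | h
  · exact h
  exfalso
  have hM : ∀ n, Integrable (maxBirkhoff T g n) μ := integrable_maxBirkhoff hmp hg
  have hMT : ∀ n, Integrable (fun x => maxBirkhoff T g n (T x)) μ := fun n =>
    hmp.integrable_comp_of_integrable (hM n)
  have hint : ∀ n, 0 ≤ ∫ x, (maxBirkhoff T g (n + 1) x - maxBirkhoff T g n (T x)) ∂μ := by
    intro n
    have hcomp : ∫ x, maxBirkhoff T g n (T x) ∂μ = ∫ x, maxBirkhoff T g n x ∂μ := by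
      have h1 := (hM n).aestronglyMeasurable
      rw [← hmp.map_eq] at h1
      have := integral_map hmp.measurable.aemeasurable h1
      rw [hmp.map_eq] at this
      exact this.symm
    rw [integral_sub (hM _) (hMT n), hcomp, sub_nonneg]
    exact integral_mono (hM _) (hM _) (maxBirkhoff_le_succ n)
  have hlim : Tendsto
      (fun n => ∫ x, (maxBirkhoff T g (n + 1) x - maxBirkhoff T g n (T x)) ∂μ) atTop
      (𝓝 (∫ x, g x ∂μ)) := by
    refine tendsto_integral_of_dominated_convergence (fun x => |g x|)
      (fun n => ((hM _).sub (hMT n)).aestronglyMeasurable) hg.abs ?_ ?_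
    · intro n
      refine .of_forall fun x => ?_
      have h0 := maxBirkhoff_nonneg (T := T) (g := g) n (T x)
      rw [Real.norm_eq_abs, abs_le]
      have h1 := neg_abs_le (g x)
      have h2 := le_abs_self (g x)
      have h3 := abs_nonneg (g x)
      simp only [maxBirkhoff]
      constructor
      · linarith [le_max_right 0 (g x + maxBirkhoff T g n (T x))]
      · rw [sub_le_iff_le_add]
        exact max_le (by linarith) (by linarith)
    · filter_upwards [h] with x hx
      have hTx : ¬ BddAbove (Set.range fun n => birkhoffSum T g n (T x)) := fun h' =>
        hx ((bddAbove_birkhoffSum_comp x).1 h')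
      obtain ⟨n₀, hn₀⟩ : ∃ n, -g x < birkhoffSum T g n (T x) := by
        by_contra! hcon
        exact hTx ⟨-g x, by rintro _ ⟨n, rfl⟩; exact hcon n⟩
      -- Once `M_n (T x)` exceeds `-g x`, the difference equals `g x` exactly.
      refine tendsto_const_nhds.congr' ?_
      filter_upwards [eventually_ge_atTop n₀] with n hn
      have h1 : maxBirkhoff T g n₀ (T x) ≤ maxBirkhoff T g n (T x) :=
        monotone_nat_of_le_succ (f := fun n => maxBirkhoff T g n (T x))
          (fun n => maxBirkhoff_le_succ n _) hn
      have h2 := birkhoffSum_le_maxBirkhoff (T := T) (g := g) n₀ (T x)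
      simp only [maxBirkhoff]
      rw [max_eq_right (by linarith)]
      ring
  exact absurd (ge_of_tendsto' hlim hint) (not_le.2 hneg)

theorem ae_eventually_birkhoffAverage_lt [IsProbabilityMeasure μ] (hT : Ergodic T μ)
    (hgm : Measurable g) (hg : Integrable g μ) {c : ℝ} (hc : ∫ x, g x ∂μ < c) :
    ∀ᵐ x ∂μ, ∀ᶠ n in atTop, birkhoffAverage ℝ T g n x < c := by
  obtain ⟨b, hb, hbc⟩ := exists_between hc
  have hneg : ∫ x, (g x - b) ∂μ < 0 := by
    rw [integral_sub hg (integrable_const _)]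
    simpa using hb
  -- Sums of `g - b` bounded by `B` give averages of `g` at most `b + B / n`.
  filter_upwards [ae_bddAbove_birkhoffSum hT (hgm.sub_const b) (hg.sub (integrable_const b)) hneg]
    with x hx
  obtain ⟨B, hB⟩ := hx
  have hlim : Tendsto (fun n : ℕ => b + B / (n : ℝ)) atTop (𝓝 b) := by
    simpa using (tendsto_const_div_atTop_nhds_zero_nat B).const_add b
  filter_upwards [hlim.eventually_lt_const hbc, eventually_gt_atTop 0] with n hn hn0
  refine lt_of_le_of_lt ?_ hn
  have h1 : birkhoffSum T (fun x => g x - b) n x ≤ B := hB ⟨n, rfl⟩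
  have h2 : birkhoffSum T (fun x => g x - b) n x = birkhoffSum T g n x - n * b := by
    simp [birkhoffSum, Finset.sum_sub_distrib]
  rw [h2] at h1
  have hn' : (0 : ℝ) < n := by exact_mod_cast hn0
  rw [birkhoffAverage, smul_eq_mul, inv_mul_eq_div, div_le_iff₀ hn', add_mul,
    div_mul_cancel₀ _ hn'.ne']
  linarith

/-- Birkhoff's pointwise ergodic theorem for an ergodic map. -/
theorem ae_tendsto_birkhoffAverage [IsProbabilityMeasure μ] (hT : Ergodic T μ)
    (hgm : Measurable g) (hg : Integrable g μ) :
    ∀ᵐ x ∂μ, Tendsto (fun n => birkhoffAverage ℝ T g n x) atTop (𝓝 (∫ x, g x ∂μ)) := by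
  have hup : ∀ᵐ x ∂μ, ∀ k : ℕ, ∀ᶠ n in atTop,
      birkhoffAverage ℝ T g n x < ∫ x, g x ∂μ + 1 / ((k : ℝ) + 1) :=
    ae_all_iff.2 fun k => ae_eventually_birkhoffAverage_lt hT hgm hg
      (lt_add_of_pos_right _ Nat.one_div_pos_of_nat)
  have hlow : ∀ᵐ x ∂μ, ∀ k : ℕ, ∀ᶠ n in atTop,
      birkhoffAverage ℝ T (-g) n x < -∫ x, g x ∂μ + 1 / ((k : ℝ) + 1) := by
    refine ae_all_iff.2 fun k => ae_eventually_birkhoffAverage_lt hT hgm.neg hg.neg ?_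
    simp only [Pi.neg_apply, integral_neg]
    exact lt_add_of_pos_right _ Nat.one_div_pos_of_nat
  filter_upwards [hup, hlow] with x h1 h2
  refine tendsto_order.2 ⟨fun a ha => ?_, fun a ha => ?_⟩
  · obtain ⟨k, hk⟩ := exists_nat_one_div_lt (sub_pos.2 ha)
    filter_upwards [h2 k] with n hn
    simp only [birkhoffAverage_neg, Pi.neg_apply] at hn
    linarith
  · obtain ⟨k, hk⟩ := exists_nat_one_div_lt (sub_pos.2 ha)
    filter_upwards [h1 k] with n hn
    linarith

end PointwiseErgodic

/-! ### Ergodicity of skew products over the Bernoulli shift -/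

section SkewProduct

/-- The sequence with first term `u` and with the terms of `w` after it. -/
def seqCons {U : Type*} (u : U) (w : ℕ → U) : ℕ → U
  | 0 => u
  | n + 1 => w n

/-- The skew product over the one-sided shift which is driven by the maps `F (·, u)`. -/
def skewProduct {M U : Type*} (F : M × U → M) (p : M × (ℕ → U)) : M × (ℕ → U) :=
  (F (p.1, p.2 0), fun n => p.2 (n + 1))

variable {M U : Type*} [MeasurableSpace M] [MeasurableSpace U]

theorem measurable_seqCons : Measurable fun p : U × (ℕ → U) => seqCons p.1 p.2 := by
  refine measurable_pi_iff.2 fun n => ?_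
  cases n with
  | zero => exact measurable_fst
  | succ n => exact (measurable_pi_apply n).comp measurable_snd

theorem measurable_skewProduct {F : M × U → M} (hF : Measurable F) :
    Measurable (skewProduct F) := by
  unfold skewProduct
  fun_prop

variable {ν : Measure M} {lam : Measure U} [IsProbabilityMeasure lam]

theorem measurePreserving_seqCons :
    MeasurePreserving (fun p : U × (ℕ → U) => seqCons p.1 p.2)
      (lam.prod (Measure.infinitePi fun _ : ℕ => lam)) (Measure.infinitePi fun _ : ℕ => lam) := by
  refine ⟨measurable_seqCons, Measure.eq_infinitePi _ fun s t ht => ?_⟩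
  classical
  obtain ⟨n, hn⟩ : ∃ n : ℕ, s ⊆ Finset.range (n + 1) :=
    ⟨s.sup id, fun i hi => Finset.mem_range_succ_iff.2 (Finset.le_sup (f := id) hi)⟩
  -- Padding with `univ` turns the cylinder over `s` into one over an initial segment, from which
  -- coordinate `0` splits off.
  set t' : ℕ → Set U := fun i => if i ∈ s then t i else Set.univ with ht'
  have ht'm : ∀ i, MeasurableSet (t' i) := by
    intro i
    by_cases hi : i ∈ s
    · simpa [ht', hi] using ht i
    · simp [ht', hi]
  have hpre : (fun p : U × (ℕ → U) => seqCons p.1 p.2) ⁻¹' (Set.pi s t) =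
      t' 0 ×ˢ Set.pi (Finset.range n) fun i => t' (i + 1) := by
    ext ⟨u, w⟩
    simp only [Set.mem_preimage, Set.mem_pi, Set.mem_prod, Finset.mem_coe, ht']
    constructor
    · intro h
      refine ⟨?_, fun i _ => ?_⟩
      · split_ifs with h0
        · exact h 0 h0
        · trivial
      · split_ifs with h0
        · exact h (i + 1) h0
        · trivial
    · rintro ⟨h0, h1⟩ i hi
      cases i with
      | zero =>
        rw [if_pos hi] at h0
        exact h0
      | succ i =>
        have := h1 i (by have := Finset.mem_range.1 (hn hi); simp; omega)
        rw [if_pos hi] at this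
        exact this
  rw [Measure.map_apply measurable_seqCons (.pi s.countable_toSet fun i _ => ht i), hpre,
    Measure.prod_prod, Measure.infinitePi_pi _ fun i _ => ht'm (i + 1), mul_comm,
    ← Finset.prod_range_succ' (fun i => lam (t' i)), ← Finset.prod_subset hn]
  · refine Finset.prod_congr rfl fun i hi => ?_
    simp [ht', hi]
  · intro i _ hi
    simp [ht', hi]

theorem infinitePi_eq_lintegral_seqCons {W : Set (ℕ → U)} (hW : MeasurableSet W) :
    Measure.infinitePi (fun _ : ℕ => lam) W =
      ∫⁻ u, Measure.infinitePi (fun _ : ℕ => lam) {w | seqCons u w ∈ W} ∂lam := by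
  conv_lhs => rw [← (measurePreserving_seqCons (lam := lam)).measure_preimage hW.nullMeasurableSet]
  rw [Measure.prod_apply (measurable_seqCons hW)]
  rfl

/-- Splitting off the first coordinate of the sequence turns the skew product into `F × id`. -/
theorem measurePreserving_skewProduct [SFinite ν] {F : M × U → M}
    (hF : MeasurePreserving F (ν.prod lam) ν) :
    MeasurePreserving (skewProduct F) (ν.prod (Measure.infinitePi fun _ : ℕ => lam))
      (ν.prod (Measure.infinitePi fun _ : ℕ => lam)) := by
  set P := Measure.infinitePi fun _ : ℕ => lam
  have h1 : MeasurePreserving (Prod.map id fun p : U × (ℕ → U) => seqCons p.1 p.2)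
      (ν.prod (lam.prod P)) (ν.prod P) := (MeasurePreserving.id ν).prod measurePreserving_seqCons
  have h2 : MeasurePreserving (MeasurableEquiv.prodAssoc (α := M) (β := U) (γ := ℕ → U))
      ((ν.prod lam).prod P) (ν.prod (lam.prod P)) := measurePreserving_prodAssoc ν lam P
  have h3 : MeasurePreserving (Prod.map F id) ((ν.prod lam).prod P) (ν.prod P) :=
    hF.prod (MeasurePreserving.id P)
  refine ⟨measurable_skewProduct hF.measurable, ?_⟩
  conv_lhs => rw [← (h1.comp h2).map_eq]
  rw [Measure.map_map (measurable_skewProduct hF.measurable) (h1.comp h2).measurable,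
    ← h3.map_eq]
  rfl

theorem ae_ae_comp_of_ae [SFinite ν] {F : M × U → M} (hF : MeasurePreserving F (ν.prod lam) ν)
    {p : M → Prop} (hp : ∀ᵐ m ∂ν, p m) : ∀ᵐ m ∂ν, ∀ᵐ u ∂lam, p (F (m, u)) :=
  Measure.ae_ae_of_ae_prod (hF.quasiMeasurePreserving.ae hp)

/-- The sections of an invariant set are independent of cylinders. By invariance, fixing the first
letter `u` replaces the section at `m` by the one at `F (m, u)`, which is again a typical point
since `F` preserves `ν`. The null set of `m` does not depend on `t`. -/
theorem measure_section_inter_cylinder [SFinite ν] {F : M × U → M}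
    (hF : MeasurePreserving F (ν.prod lam) ν) {E : Set (M × (ℕ → U))} (hE : MeasurableSet E)
    (hinv : skewProduct F ⁻¹' E = E) {c : ℝ≥0∞}
    (hc : ∀ᵐ m ∂ν, Measure.infinitePi (fun _ : ℕ => lam) {w | (m, w) ∈ E} = c) (n : ℕ) :
    ∀ᵐ m ∂ν, ∀ t : ℕ → Set U, (∀ i, MeasurableSet (t i)) →
      Measure.infinitePi (fun _ : ℕ => lam) {w | (m, w) ∈ E ∧ ∀ i < n, w i ∈ t i} =
        c * ∏ i ∈ Finset.range n, lam (t i) := by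
  induction n with
  | zero =>
    filter_upwards [hc] with m hm t _
    simpa using hm
  | succ n ih =>
    filter_upwards [ae_ae_comp_of_ae hF ih] with m hm t ht
    have hmeas : MeasurableSet {w | (m, w) ∈ E ∧ ∀ i < n + 1, w i ∈ t i} := by
      have h1 : MeasurableSet {w | (m, w) ∈ E} := measurable_prodMk_left hE
      have h2 : MeasurableSet {w : ℕ → U | ∀ i < n + 1, w i ∈ t i} := by
        have : {w : ℕ → U | ∀ i < n + 1, w i ∈ t i} = ⋂ i < n + 1, {w | w i ∈ t i} := by
          ext w; simp
        rw [this]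
        exact .iInter fun i => .iInter fun _ => measurable_pi_apply i (ht i)
      exact h1.inter h2
    have hsec : ∀ u w, (seqCons u w ∈ {w | (m, w) ∈ E ∧ ∀ i < n + 1, w i ∈ t i}) ↔
        (u ∈ t 0 ∧ (F (m, u), w) ∈ E ∧ ∀ i < n, w i ∈ t (i + 1)) := by
      intro u w
      have h1 : (m, seqCons u w) ∈ E ↔ (F (m, u), w) ∈ E := by
        conv_lhs => rw [← hinv]
        rfl
      have h2 : (∀ i < n + 1, seqCons u w i ∈ t i) ↔ u ∈ t 0 ∧ ∀ i < n, w i ∈ t (i + 1) := by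
        constructor
        · intro h
          exact ⟨h 0 (by omega), fun i hi => h (i + 1) (by omega)⟩
        · rintro ⟨h0, h⟩ i hi
          cases i with
          | zero => exact h0
          | succ i => exact h i (by omega)
      change ((m, seqCons u w) ∈ E ∧ ∀ i < n + 1, seqCons u w i ∈ t i) ↔ _
      rw [h1, h2]
      tauto
    rw [infinitePi_eq_lintegral_seqCons hmeas]
    have : ∀ᵐ u ∂lam, Measure.infinitePi (fun _ : ℕ => lam)
        {w | seqCons u w ∈ {w | (m, w) ∈ E ∧ ∀ i < n + 1, w i ∈ t i}} =
        (t 0).indicator (fun _ => c * ∏ i ∈ Finset.range n, lam (t (i + 1))) u := by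
      filter_upwards [hm] with u hu
      have hset : {w | seqCons u w ∈ {w | (m, w) ∈ E ∧ ∀ i < n + 1, w i ∈ t i}} =
          {w | u ∈ t 0 ∧ (F (m, u), w) ∈ E ∧ ∀ i < n, w i ∈ t (i + 1)} := Set.ext (hsec u)
      refine (congrArg (Measure.infinitePi fun _ : ℕ => lam) hset).trans ?_
      by_cases h0 : u ∈ t 0
      · simpa [h0] using hu (fun i => t (i + 1)) fun i => ht (i + 1)
      · simp [h0]
    rw [lintegral_congr_ae this, lintegral_indicator_const (ht 0), Finset.prod_range_succ',
      mul_assoc]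

/-- If `c ≠ 0`, the normalized restriction of the product measure to `W` agrees with it on
cylinders, so the two coincide and `Wᶜ` is null. -/
theorem eq_zero_or_one_of_forall_cylinder {W : Set (ℕ → U)} (hW : MeasurableSet W) {c : ℝ≥0∞}
    (h : ∀ n, ∀ t : ℕ → Set U, (∀ i, MeasurableSet (t i)) →
      Measure.infinitePi (fun _ : ℕ => lam) {w | w ∈ W ∧ ∀ i < n, w i ∈ t i} =
        c * ∏ i ∈ Finset.range n, lam (t i)) : c = 0 ∨ c = 1 := by
  classical
  set P := Measure.infinitePi fun _ : ℕ => lam with hP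
  have hc : P W = c := by simpa using h 0 (fun _ => Set.univ) fun _ => .univ
  have hctop : c ≠ ∞ := hc ▸ measure_ne_top P W
  refine or_iff_not_imp_left.2 fun h0 => ?_
  have key : c⁻¹ • P.restrict W = P := by
    refine Measure.eq_infinitePi _ fun s t ht => ?_
    obtain ⟨n, hn⟩ : ∃ n : ℕ, s ⊆ Finset.range n :=
      ⟨s.sup id + 1, fun i hi => Finset.mem_range_succ_iff.2 (Finset.le_sup (f := id) hi)⟩
    set t' : ℕ → Set U := fun i => if i ∈ s then t i else Set.univ with ht'
    have ht'm : ∀ i, MeasurableSet (t' i) := by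
      intro i
      by_cases hi : i ∈ s
      · simpa [ht', hi] using ht i
      · simp [ht', hi]
    have hset : Set.pi s t ∩ W = {w | w ∈ W ∧ ∀ i < n, w i ∈ t' i} := by
      ext w
      simp only [Set.mem_inter_iff, Set.mem_pi, Finset.mem_coe, Set.mem_ofPred_eq, ht']
      constructor
      · rintro ⟨h1, h2⟩
        refine ⟨h2, fun i _ => ?_⟩
        split_ifs with hi
        · exact h1 i hi
        · trivial
      · rintro ⟨h1, h2⟩
        refine ⟨fun i hi => ?_, h1⟩
        simpa [hi] using h2 i (Finset.mem_range.1 (hn hi))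
    rw [Measure.smul_apply, Measure.restrict_apply (.pi s.countable_toSet fun i _ => ht i), hset,
      h n t' ht'm, smul_eq_mul, ← mul_assoc, ENNReal.inv_mul_cancel h0 hctop, one_mul,
      ← Finset.prod_subset hn]
    · refine Finset.prod_congr rfl fun i hi => ?_
      simp [ht', hi]
    · intro i _ hi
      simp [ht', hi]
  have h1 : P Wᶜ = 0 := by
    conv_lhs => rw [← key]
    simp [Measure.restrict_apply hW.compl]
  rw [← hc, ← prob_compl_eq_zero_iff hW]
  exact h1

/-- A skew product over the one-sided Bernoulli shift is ergodic if the bounded harmonic functions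
of the Markov chain which it induces on the fibre are almost everywhere constant. -/
theorem ergodic_skewProduct [IsProbabilityMeasure ν] {F : M × U → M}
    (hF : MeasurePreserving F (ν.prod lam) ν)
    (hharm : ∀ h : M → ℝ≥0∞, Measurable h → (∀ m, h m ≤ 1) →
      (∀ m, h m = ∫⁻ u, h (F (m, u)) ∂lam) → ∃ c, ∀ᵐ m ∂ν, h m = c) :
    Ergodic (skewProduct F) (ν.prod (Measure.infinitePi fun _ : ℕ => lam)) := by
  refine ⟨measurePreserving_skewProduct hF, ⟨fun E hE hinv => ?_⟩⟩
  set P := Measure.infinitePi fun _ : ℕ => lam with hP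
  -- The measure of the section at `m` is harmonic because `E` is invariant.
  obtain ⟨c, hc⟩ := hharm (fun m => P {w | (m, w) ∈ E}) (measurable_measure_prodMk_left hE)
    (fun m => prob_le_one) (fun m => by
      have hEm : MeasurableSet {w | (m, w) ∈ E} := measurable_prodMk_left hE
      rw [hP, infinitePi_eq_lintegral_seqCons hEm]
      refine lintegral_congr fun u => ?_
      congr 1
      ext w
      change (m, seqCons u w) ∈ E ↔ (F (m, u), w) ∈ E
      conv_lhs => rw [← hinv]
      rfl)
  have hcyl := ae_all_iff.2 (measure_section_inter_cylinder hF hE hinv hc)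
  obtain ⟨m, hm⟩ := hcyl.exists
  have hEc : ν.prod P E = c := by
    rw [Measure.prod_apply hE]
    have : ∀ᵐ m ∂ν, P (Prod.mk m ⁻¹' E) = c := hc
    rw [lintegral_congr_ae this]
    simp
  rcases eq_zero_or_one_of_forall_cylinder (measurable_prodMk_left hE : MeasurableSet
    {w | (m, w) ∈ E}) hm with h0 | h1
  · exact eventuallyConst_set.2 (Or.inr (measure_eq_zero_iff_ae_notMem.1 (hEc.trans h0)))
  · refine eventuallyConst_set.2 (Or.inl ?_)
    rw [h1, ← prob_compl_eq_zero_iff hE] at hEc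
    exact hEc

end SkewProduct

/-! ### The Markov chain of differences and its stationary density -/

section Displacement

variable {A : Set Circ} {v : Circ}

theorem image_translation (A : Set Circ) (d : Circ) : translation d '' A = {x | x - d ∈ A} := by
  ext x
  constructor
  · rintro ⟨y, hy, rfl⟩
    simpa [translation] using hy
  · intro hx
    exact ⟨x - d, hx, by simp [translation]⟩

/-- Half of the displacement: the measure of the part of `A` which leaves `A` under the translation
by `-d`. -/
noncomputable def escapeMeasure (A : Set Circ) (d : Circ) : ℝ≥0∞ :=
  volume (A \ {x | x - d ∈ A})

theorem measurableSet_sub_mem (hA : MeasurableSet A) (d : Circ) :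
    MeasurableSet {x : Circ | x - d ∈ A} :=
  (measurable_id.sub_const d) hA

theorem volume_sub_mem (hA : MeasurableSet A) (d : Circ) :
    volume {x : Circ | x - d ∈ A} = volume A :=
  (measurePreserving_sub_right volume d).measure_preimage hA.nullMeasurableSet

/-- `A` and its translate have the same measure, so removing their intersection leaves equal
measures. -/
theorem escapeMeasure_eq (hA : MeasurableSet A) (d : Circ) :
    volume ({x | x - d ∈ A} \ A) = escapeMeasure A d := by
  have h1 := measure_inter_add_sdiff (μ := volume) A (measurableSet_sub_mem hA d)
  have h2 := measure_inter_add_sdiff (μ := volume) {x : Circ | x - d ∈ A} hA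
  rw [volume_sub_mem hA d, Set.inter_comm, ← h1] at h2
  exact (ENNReal.add_right_inj (measure_ne_top _ _)).1 h2

theorem ofReal_displacement (hA : MeasurableSet A) (d : Circ) :
    ENNReal.ofReal (displacement A d) = escapeMeasure A d + escapeMeasure A d := by
  rw [displacement, ofReal_measureReal (measure_ne_top _ _), image_translation,
    measure_symmDiff_eq hA.nullMeasurableSet (measurableSet_sub_mem hA d).nullMeasurableSet,
    escapeMeasure_eq hA, escapeMeasure]

theorem invDisplacement_eq (hA : MeasurableSet A) (d : Circ) :
    invDisplacement A d = (escapeMeasure A d + escapeMeasure A d)⁻¹ := by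
  rw [invDisplacement, ofReal_displacement hA]

/-- The probability that the difference stays at `d`. -/
noncomputable def stayMeasure (A : Set Circ) (d : Circ) : ℝ≥0∞ :=
  volume (A ∆ {x | x - d ∈ A})ᶜ

theorem stayMeasure_add (hA : MeasurableSet A) (d : Circ) :
    stayMeasure A d + (escapeMeasure A d + escapeMeasure A d) = 1 := by
  have h := ofReal_displacement hA d
  rw [displacement, ofReal_measureReal (measure_ne_top _ _), image_translation] at h
  rw [← h, stayMeasure, add_comm,
    measure_add_measure_compl (hA.symmDiff (measurableSet_sub_mem hA d)), measure_univ]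

theorem escapeMeasure_ne_top (A : Set Circ) (d : Circ) : escapeMeasure A d ≠ ∞ :=
  measure_ne_top _ _

theorem escapeMeasure_ne_zero (hA : MeasurableSet A) (hsymm : NoTranslationalSymmetries A)
    {d : Circ} (hd : d ≠ 0) : escapeMeasure A d ≠ 0 := by
  intro h
  have h1 := ofReal_displacement hA d
  rw [h, add_zero, ENNReal.ofReal_eq_zero] at h1
  exact hd ((hsymm d).1 (le_antisymm h1 measureReal_nonneg))

theorem measurable_escapeMeasure (hA : MeasurableSet A) : Measurable (escapeMeasure A) := by
  have h : MeasurableSet {p : Circ × Circ | p.2 ∈ A ∧ p.2 - p.1 ∉ A} :=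
    (measurable_snd hA).inter ((measurable_snd.sub measurable_fst) hA.compl)
  exact measurable_measure_prodMk_left h

theorem measurable_invDisplacement (hA : MeasurableSet A) : Measurable (invDisplacement A) := by
  rw [funext (invDisplacement_eq hA)]
  exact ((measurable_escapeMeasure hA).add (measurable_escapeMeasure hA)).inv

theorem one_le_invDisplacement (hA : MeasurableSet A) (d : Circ) : 1 ≤ invDisplacement A d := by
  rw [invDisplacement_eq hA, ENNReal.one_le_inv, ← stayMeasure_add hA d]
  exact le_add_self

theorem measurable_doubleRotation (hA : MeasurableSet A) (v : Circ) :
    Measurable (doubleRotation A v) := by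
  classical
  exact Measurable.ite hA (measurable_id.add_const v) measurable_id

/-- The law of the difference of two points after one step of the double rotation, when the first
point is uniformly distributed and their difference is `d`. -/
theorem lintegral_comp_difference (hA : MeasurableSet A) (v d : Circ) (K : Circ → ℝ≥0∞) :
    ∫⁻ x : Circ, K (doubleRotation A v x - doubleRotation A v (x - d)) =
      stayMeasure A d * K d + escapeMeasure A d * (K (d + v) + K (d - v)) := by
  have hB := measurableSet_sub_mem hA d
  have hpt : ∀ x : Circ, K (doubleRotation A v x - doubleRotation A v (x - d)) =
      (A ∆ {x | x - d ∈ A})ᶜ.indicator (fun _ => K d) x +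
        ((A \ {x | x - d ∈ A}).indicator (fun _ => K (d + v)) x +
          ({x | x - d ∈ A} \ A).indicator (fun _ => K (d - v)) x) := by
    intro x
    by_cases h1 : x ∈ A <;> by_cases h2 : x - d ∈ A <;>
      simp [doubleRotation, Set.indicator, h1, h2] <;> congr 1 <;> abel
  rw [lintegral_congr hpt,
    lintegral_add_left (measurable_const.indicator (hA.symmDiff hB).compl),
    lintegral_add_left (measurable_const.indicator (hA.diff hB)),
    lintegral_indicator_const (hA.symmDiff hB).compl, lintegral_indicator_const (hA.diff hB),
    lintegral_indicator_const (hB.diff hA), escapeMeasure_eq hA, stayMeasure, escapeMeasure,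
    mul_comm (K d), mul_comm (K (d + v)), mul_comm (K (d - v)), mul_add]

theorem volume_singleton (d : Circ) : (volume : Measure Circ) {d} = 0 := by
  rw [← Metric.closedBall_zero, AddCircle.volume_closedBall]
  simp

theorem ae_ne_zero : ∀ᵐ d : Circ, d ≠ 0 := by
  rw [ae_iff]
  simpa using volume_singleton (0 : Circ)

/-- Off `0` the rate of each jump is `1 / 2`; translation invariance of Lebesgue measure then
balances the mass that leaves against the mass that arrives. -/
theorem lintegral_invDisplacement_mul_transition (hA : MeasurableSet A)
    (hsymm : NoTranslationalSymmetries A) (v : Circ) {K : Circ → ℝ≥0∞} (hK : Measurable K) :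
    ∫⁻ d, invDisplacement A d *
        (stayMeasure A d * K d + escapeMeasure A d * (K (d + v) + K (d - v))) =
      ∫⁻ d, invDisplacement A d * K d := by
  have hstay : Measurable (stayMeasure A) := by
    have h : MeasurableSet {p : Circ × Circ | p.2 ∈ (A ∆ {x | x - p.1 ∈ A})ᶜ} :=
      ((measurable_snd hA).symmDiff ((measurable_snd.sub measurable_fst) hA)).compl
    exact measurable_measure_prodMk_left h
  have hinv := measurable_invDisplacement hA
  have h1 : ∀ᵐ d : Circ, invDisplacement A d *
        (stayMeasure A d * K d + escapeMeasure A d * (K (d + v) + K (d - v))) =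
      invDisplacement A d * stayMeasure A d * K d + (2⁻¹ * K (d + v) + 2⁻¹ * K (d - v)) := by
    -- At `d = 0` the product is `∞ * 0 = 0`, not `1 / 2`; a single point is negligible.
    filter_upwards [ae_ne_zero] with d hd
    have hp := escapeMeasure_ne_zero hA hsymm hd
    have : invDisplacement A d * escapeMeasure A d = 2⁻¹ := by
      rw [invDisplacement_eq hA, ← two_mul,
        ENNReal.mul_inv (Or.inl (by norm_num)) (Or.inl (by norm_num)), mul_assoc,
        ENNReal.inv_mul_cancel hp (escapeMeasure_ne_top A d), mul_one]
    rw [mul_add, ← mul_assoc, ← mul_assoc, this, mul_add]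
  have h2 : ∀ᵐ d : Circ, invDisplacement A d * K d =
      invDisplacement A d * stayMeasure A d * K d + K d := by
    filter_upwards [ae_ne_zero] with d hd
    have hp := escapeMeasure_ne_zero hA hsymm hd
    have hcancel : invDisplacement A d * (escapeMeasure A d + escapeMeasure A d) = 1 := by
      rw [invDisplacement_eq hA]
      exact ENNReal.inv_mul_cancel (by simp [hp]) (by simp [escapeMeasure_ne_top])
    conv_lhs => rw [← mul_one (invDisplacement A d), ← stayMeasure_add hA d, mul_add, hcancel,
      add_mul, one_mul]
  rw [lintegral_congr_ae h1, lintegral_congr_ae h2, lintegral_add_left (by fun_prop),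
    lintegral_add_left (by fun_prop), lintegral_add_left (by fun_prop),
    lintegral_const_mul _ (by fun_prop), lintegral_const_mul _ (by fun_prop),
    lintegral_add_right_eq_self (μ := volume) K v, lintegral_sub_right_eq_self K v,
    ← add_mul, ENNReal.inv_two_add_inv_two, one_mul]

end Displacement

/-! ### The limit measure and its equivalence with Lebesgue measure -/

section LimitMeasure

variable {A : Set Circ}

theorem normalizer_ne_zero (hA : MeasurableSet A) : normalizer A ≠ 0 := by
  have : (1 : ℝ≥0∞) ≤ normalizer A := by
    calc (1 : ℝ≥0∞) = ∫⁻ _ : Circ, 1 := by simp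
      _ ≤ normalizer A := lintegral_mono fun d => one_le_invDisplacement hA d
  exact (zero_lt_one.trans_le this).ne'

theorem isProbabilityMeasure_limitMeasure (hA : MeasurableSet A) (hint : normalizer A < ∞) :
    IsProbabilityMeasure (limitMeasure A) := by
  refine ⟨?_⟩
  rw [limitMeasure, Measure.smul_apply, withDensity_apply _ .univ, Measure.restrict_univ,
    smul_eq_mul]
  exact ENNReal.inv_mul_cancel (normalizer_ne_zero hA) hint.ne

theorem limitMeasure_absolutelyContinuous (A : Set Circ) : limitMeasure A ≪ volume :=
  (withDensity_absolutelyContinuous _ _).smul_left _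

theorem absolutelyContinuous_limitMeasure (hA : MeasurableSet A) (hint : normalizer A < ∞) :
    (volume : Measure Circ) ≪ limitMeasure A := by
  have h : (volume : Measure Circ) ≪ volume.withDensity (invDisplacement A) :=
    withDensity_absolutelyContinuous' (measurable_invDisplacement hA).aemeasurable
      (.of_forall fun d => (zero_lt_one.trans_le (one_le_invDisplacement hA d)).ne')
  exact h.trans (Measure.absolutelyContinuous_smul (ENNReal.inv_ne_zero.2 hint.ne))

theorem limitMeasure_singleton_zero (A : Set Circ) : limitMeasure A {0} = 0 :=
  limitMeasure_absolutelyContinuous A (volume_singleton 0)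

theorem lintegral_limitMeasure (hA : MeasurableSet A) {K : Circ → ℝ≥0∞} (hK : Measurable K) :
    ∫⁻ d, K d ∂limitMeasure A = (normalizer A)⁻¹ * ∫⁻ d, invDisplacement A d * K d := by
  rw [limitMeasure, lintegral_smul_measure,
    lintegral_withDensity_eq_lintegral_mul _ (measurable_invDisplacement hA) hK]
  rfl

end LimitMeasure

/-! ### Bounded harmonic functions of the difference chain -/

section Harmonic

variable {A : Set Circ} {v : Circ}

/-- The midpoint relation makes `a` affine, and a bounded affine sequence has slope zero. -/
theorem eq_of_bounded_of_midpoint {a : ℕ → ℝ} (h0 : ∀ n, 0 ≤ a n) (h1 : ∀ n, a n ≤ 1)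
    (h : ∀ n, 2 * a (n + 1) = a (n + 2) + a n) : a 1 = a 0 := by
  have haff : ∀ n : ℕ, a n = a 0 + n * (a 1 - a 0) ∧ a (n + 1) = a 0 + (n + 1) * (a 1 - a 0) := by
    intro n
    induction n with
    | zero => simp
    | succ n ih =>
      refine ⟨by rw [ih.2]; push_cast; ring, ?_⟩
      have := h n
      push_cast
      linarith
  by_contra hne
  obtain ⟨n, hn⟩ := exists_nat_gt (1 / |a 1 - a 0|)
  have hpos : 0 < |a 1 - a 0| := abs_pos.2 (sub_ne_zero.2 hne)
  rw [div_lt_iff₀ hpos] at hn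
  have h2 : |(n : ℝ) * (a 1 - a 0)| ≤ 1 := by
    rw [abs_le]
    constructor <;> linarith [(haff n).1, h0 n, h1 n, h0 0, h1 0]
  rw [abs_mul, Nat.abs_cast] at h2
  linarith

theorem addOrderOf_coe_of_irrational {θ : ℝ} (hθ : Irrational θ) :
    addOrderOf (θ : Circ) = 0 := by
  rw [addOrderOf_eq_zero_iff']
  intro n hn h
  rw [← AddCircle.coe_nsmul, AddCircle.coe_eq_zero_iff] at h
  obtain ⟨m, hm⟩ := h
  refine hθ ⟨(m : ℚ) / n, ?_⟩
  have hn' : (n : ℝ) ≠ 0 := by exact_mod_cast hn.ne'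
  push_cast
  rw [div_eq_iff hn']
  simpa [mul_comm] using hm

theorem ae_add_ne_zero (c : Circ) : ∀ᵐ d : Circ, d + c ≠ 0 := by
  have h : (volume : Measure Circ) {-c} = 0 := volume_singleton (-c)
  filter_upwards [measure_eq_zero_iff_ae_notMem.1 h] with d hd h0
  exact hd (eq_neg_of_add_eq_zero_left h0)

/-- Substitute `1 - 2p` for the probability of staying and cancel `p`, which is nonzero only because
`d ≠ 0`. -/
theorem midpoint_of_harmonic (hA : MeasurableSet A) (hsymm : NoTranslationalSymmetries A)
    {H : Circ → ℝ≥0∞} (hle : ∀ d, H d ≤ 1)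
    (hH : ∀ d, H d = stayMeasure A d * H d + escapeMeasure A d * (H (d + v) + H (d - v)))
    {d : Circ} (hd : d ≠ 0) :
    2 * (H d).toReal = (H (d + v)).toReal + (H (d - v)).toReal := by
  have htop : ∀ d, H d ≠ ∞ := fun d => ((hle d).trans_lt ENNReal.one_lt_top).ne
  have hp := escapeMeasure_ne_top A d
  have hq : stayMeasure A d ≠ ∞ := measure_ne_top _ _
  have e1 := congrArg ENNReal.toReal (hH d)
  have e2 := congrArg ENNReal.toReal (stayMeasure_add hA d)
  rw [ENNReal.toReal_add (ENNReal.mul_ne_top hq (htop d))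
    (ENNReal.mul_ne_top hp (ENNReal.add_ne_top.2 ⟨htop _, htop _⟩)), ENNReal.toReal_mul,
    ENNReal.toReal_mul, ENNReal.toReal_add (htop _) (htop _)] at e1
  rw [ENNReal.toReal_add hq (ENNReal.add_ne_top.2 ⟨hp, hp⟩), ENNReal.toReal_add hp hp,
    ENNReal.toReal_one] at e2
  have hpos : (escapeMeasure A d).toReal ≠ 0 :=
    ENNReal.toReal_ne_zero.2 ⟨escapeMeasure_ne_zero hA hsymm hd, hp⟩
  have e3 : (escapeMeasure A d).toReal *
      (2 * (H d).toReal - ((H (d + v)).toReal + (H (d - v)).toReal)) = 0 := by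
    rw [← eq_sub_iff_add_eq] at e2
    rw [e2] at e1
    linarith
  exact sub_eq_zero.1 ((mul_eq_zero.1 e3).resolve_left hpos)

theorem ae_eq_const_of_harmonic (hA : MeasurableSet A) (hsymm : NoTranslationalSymmetries A)
    (hv : addOrderOf v = 0) {H : Circ → ℝ≥0∞} (hHm : Measurable H) (hle : ∀ d, H d ≤ 1)
    (hH : ∀ d, H d = stayMeasure A d * H d + escapeMeasure A d * (H (d + v) + H (d - v))) :
    ∃ c, ∀ᵐ d : Circ, H d = c := by
  have htop : ∀ d, H d ≠ ∞ := fun d => ((hle d).trans_lt ENNReal.one_lt_top).ne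
  -- The midpoint relation is needed only at the centres `d + (n + 1) • v`; keeping them off `0`
  -- excludes countably many `d`.
  have hne : ∀ᵐ d : Circ, ∀ n : ℕ, d + (n + 1) • v ≠ 0 := by
    refine ae_all_iff.2 fun n => ?_
    exact ae_add_ne_zero _
  have hinv : (H ∘ fun d => d + v) =ᵐ[volume] H := by
    filter_upwards [hne] with d hd
    have := eq_of_bounded_of_midpoint (a := fun n => (H (d + n • v)).toReal)
      (fun n => ENNReal.toReal_nonneg)
      (fun n => ENNReal.toReal_le_of_le_ofReal zero_le_one (by simpa using hle _))
      (fun n => by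
        have := midpoint_of_harmonic hA hsymm hle hH (hd n)
        rw [show d + (n + 1) • v + v = d + (n + 2) • v by simp only [add_smul]; abel,
          show d + (n + 1) • v - v = d + n • v by simp only [add_smul]; abel] at this
        exact this)
    simp only [one_smul, zero_smul, add_zero] at this
    exact (ENNReal.toReal_eq_toReal_iff' (htop _) (htop _)).1 this
  obtain ⟨c, hc⟩ := (AddCircle.ergodic_add_right.2 hv).ae_eq_const_of_ae_eq_comp₀
    hHm.nullMeasurable hinv
  exact ⟨c, hc⟩

end Harmonic

/-! ### Ergodicity of the pair process -/

section PairProcess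

variable {A : Set Circ} {v : Circ}

/-- One step of the motion of a pair of points, given by the first point and the difference, under
the double rotation and a common shift. -/
noncomputable def pairStep (A : Set Circ) (v : Circ) (q : (Circ × Circ) × Circ) : Circ × Circ :=
  (doubleRotation A v q.1.1 + q.2,
    doubleRotation A v q.1.1 - doubleRotation A v (q.1.1 - q.1.2))

theorem measurable_difference (hA : MeasurableSet A) (v : Circ) :
    Measurable fun p : Circ × Circ => doubleRotation A v p.1 - doubleRotation A v (p.1 - p.2) := by
  have := measurable_doubleRotation hA v
  exact (this.comp measurable_fst).sub (this.comp (measurable_fst.sub measurable_snd))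

theorem measurable_pairStep (hA : MeasurableSet A) (v : Circ) : Measurable (pairStep A v) := by
  have := measurable_doubleRotation hA v
  exact ((this.comp (measurable_fst.comp measurable_fst)).add measurable_snd).prodMk
    ((measurable_difference hA v).comp measurable_fst)

theorem measurePreserving_pairStep (hA : MeasurableSet A) (hsymm : NoTranslationalSymmetries A)
    (v : Circ) [SFinite (limitMeasure A)] :
    MeasurePreserving (pairStep A v)
      (((volume : Measure Circ).prod (limitMeasure A)).prod (volume : Measure Circ))
      ((volume : Measure Circ).prod (limitMeasure A)) := by
  refine ⟨measurable_pairStep hA v, Measure.ext_of_lintegral _ fun k hk => ?_⟩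
  set K : Circ → ℝ≥0∞ := fun d => ∫⁻ u : Circ, k (u, d) with hK
  have hKm : Measurable K := hk.lintegral_prod_left'
  rw [lintegral_map hk (measurable_pairStep hA v),
    lintegral_prod (fun a => k (pairStep A v a))
      (hk.comp (measurable_pairStep hA v)).aemeasurable]
  -- Averaging over the shift makes the new first point uniform, whatever the old one was.
  have h1 : ∀ p : Circ × Circ, ∫⁻ u : Circ, k (pairStep A v (p, u)) =
      K (doubleRotation A v p.1 - doubleRotation A v (p.1 - p.2)) := fun p =>
    lintegral_add_left_eq_self (μ := (volume : Measure Circ)) (fun u : Circ =>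
      k (u, doubleRotation A v p.1 - doubleRotation A v (p.1 - p.2))) (doubleRotation A v p.1)
  rw [lintegral_congr h1,
    lintegral_prod_symm (fun p : Circ × Circ =>
      K (doubleRotation A v p.1 - doubleRotation A v (p.1 - p.2))) (hKm.comp (measurable_difference hA v)).aemeasurable]
  simp only [lintegral_comp_difference hA]
  have hm : Measurable fun d => stayMeasure A d * K d +
      escapeMeasure A d * (K (d + v) + K (d - v)) := by
    have : Measurable fun d => ∫⁻ x : Circ,
        K (doubleRotation A v x - doubleRotation A v (x - d)) :=
      (hKm.comp (measurable_difference hA v)).lintegral_prod_left'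
    simpa only [lintegral_comp_difference hA] using this
  rw [lintegral_limitMeasure hA hm, lintegral_invDisplacement_mul_transition hA hsymm v hKm,
    ← lintegral_limitMeasure hA hKm, lintegral_prod_symm _ hk.aemeasurable]

theorem ergodic_pairStep (hA : MeasurableSet A) (hsymm : NoTranslationalSymmetries A)
    (hv : addOrderOf v = 0) [IsProbabilityMeasure (limitMeasure A)] :
    Ergodic (skewProduct (pairStep A v))
      (((volume : Measure Circ).prod (limitMeasure A)).prod shiftMeasure) := by
  have hF := measurePreserving_pairStep hA hsymm v
  refine ergodic_skewProduct hF fun h hm hle hharm => ?_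
  set H : Circ → ℝ≥0∞ := fun d => ∫⁻ u : Circ, h (u, d) with hH
  have hHm : Measurable H := hm.lintegral_prod_left'
  have hfac : ∀ p : Circ × Circ,
      h p = H (doubleRotation A v p.1 - doubleRotation A v (p.1 - p.2)) := fun p =>
    (hharm p).trans <| lintegral_add_left_eq_self (μ := (volume : Measure Circ)) (fun u : Circ =>
      h (u, doubleRotation A v p.1 - doubleRotation A v (p.1 - p.2))) (doubleRotation A v p.1)
  have hHle : ∀ d, H d ≤ 1 := fun d =>
    (lintegral_mono fun u => hle (u, d)).trans (by simp)
  obtain ⟨c, hc⟩ := ae_eq_const_of_harmonic hA hsymm hv hHm hHle fun d => by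
    rw [← lintegral_comp_difference hA v d H]
    exact lintegral_congr fun x => hfac (x, d)
  refine ⟨c, ?_⟩
  have hc' : ∀ᵐ p ∂(volume : Measure Circ).prod (limitMeasure A), H p.2 = c :=
    Measure.quasiMeasurePreserving_snd.ae (limitMeasure_absolutelyContinuous A hc)
  -- By `hfac`, `h` sees only the next difference, which does not depend on `u`; so one typical `u`
  -- suffices.
  filter_upwards [ae_ae_comp_of_ae hF hc'] with p hp
  obtain ⟨u, hu⟩ := hp.exists
  rw [hfac]
  exact hu

theorem iterate_skewProduct_pairStep (w : ℕ → Circ) (n : ℕ) (x y : Circ) :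
    (skewProduct (pairStep A v))^[n] ((x, x - y), w) =
      ((randomIterate A v w n x, randomIterate A v w n x - randomIterate A v w n y),
        fun i => w (n + i)) := by
  induction n with
  | zero => simp [randomIterate]
  | succ n ih =>
    rw [Function.iterate_succ_apply', ih]
    simp only [skewProduct, pairStep, randomIterate, translation, sub_sub_cancel, add_zero,
      add_sub_add_right_eq_sub, Prod.mk.injEq, true_and]
    funext i
    congr 1
    omega

theorem ae_tendsto_average (hA : MeasurableSet A) (hsymm : NoTranslationalSymmetries A)
    (hint : normalizer A < ∞) (hv : addOrderOf v = 0) (g : C(Circ, ℝ)) :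
    ∀ᵐ p : Circ × Circ, ∀ᵐ w ∂shiftMeasure,
      Tendsto (fun N : ℕ => (N : ℝ)⁻¹ * ∑ n ∈ Finset.Icc 1 N,
        g (randomIterate A v w n p.1 - randomIterate A v w n p.2)) atTop
        (𝓝 (∫ d, g d ∂limitMeasure A)) := by
  have := isProbabilityMeasure_limitMeasure hA hint
  have : IsProbabilityMeasure shiftMeasure := by unfold shiftMeasure; infer_instance
  set G : (Circ × Circ) × (ℕ → Circ) → ℝ := fun q => g q.1.2 with hG
  have herg := ergodic_pairStep hA hsymm hv
  have hgm : Measurable g := g.continuous.measurable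
  have hGm : Measurable G := hgm.comp (measurable_snd.comp measurable_fst)
  have hGi : Integrable G
      (((volume : Measure Circ).prod (limitMeasure A)).prod shiftMeasure) :=
    Integrable.of_bound hGm.aestronglyMeasurable ‖g‖ (.of_forall fun q => g.norm_coe_le_norm _)
  have hproj : MeasurePreserving (fun q : (Circ × Circ) × (ℕ → Circ) => q.1.2)
      (((volume : Measure Circ).prod (limitMeasure A)).prod shiftMeasure) (limitMeasure A) :=
    measurePreserving_snd.comp measurePreserving_fst
  have hGint : ∫ q, G q ∂((volume : Measure Circ).prod (limitMeasure A)).prod shiftMeasure =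
      ∫ d, g d ∂limitMeasure A := by
    have := integral_map (μ := ((volume : Measure Circ).prod (limitMeasure A)).prod shiftMeasure)
      hproj.measurable.aemeasurable (f := g) hgm.aestronglyMeasurable
    rw [hproj.map_eq] at this
    exact this.symm
  -- Birkhoff averages start at time `0`, the empirical ones at time `1`; so the theorem is applied
  -- at the image point.
  have hlim := herg.quasiMeasurePreserving.ae (ae_tendsto_birkhoffAverage herg hGm hGi)
  rw [hGint] at hlim
  have hpair := Measure.ae_ae_of_ae_prod hlim
  have hac : (volume : Measure (Circ × Circ)) ≪ (volume : Measure Circ).prod (limitMeasure A) :=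
    Measure.AbsolutelyContinuous.rfl.prod (absolutelyContinuous_limitMeasure hA hint)
  have hmap : MeasurePreserving (fun p : Circ × Circ => (p.1, p.1 - p.2)) volume volume := by
    have h1 : MeasurePreserving (fun p : Circ × Circ => (p.1, p.2 - p.1)) volume volume :=
      measurePreserving_prod_sub volume volume
    have h2 : MeasurePreserving (Prod.map id Neg.neg : Circ × Circ → Circ × Circ) volume volume :=
      (MeasurePreserving.id volume).prod (Measure.measurePreserving_neg volume)
    convert! h2.comp h1 using 1
    funext p
    simp
  filter_upwards [hmap.quasiMeasurePreserving.ae (hac hpair)] with p hp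
  filter_upwards [hp] with w hw
  refine hw.congr fun N => ?_
  rw [birkhoffAverage, birkhoffSum, smul_eq_mul, ← Finset.Ico_add_one_right_eq_Icc,
    Finset.sum_Ico_eq_sum_range]
  congr 1
  refine Finset.sum_congr (by simp) fun k _ => ?_
  rw [← Function.iterate_succ_apply, iterate_skewProduct_pairStep, add_comm 1 k]

end PairProcess

/-! ### From averages of test functions to weak convergence and non-synchronization -/

section WeakConvergence

theorem tendsto_average_of_dense {z : ℕ → Circ} {μ : Measure Circ} [IsProbabilityMeasure μ]
    {D : Set C(Circ, ℝ)} (hD : Dense D)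
    (h : ∀ g ∈ D, Tendsto (fun N : ℕ => (N : ℝ)⁻¹ * ∑ n ∈ Finset.Icc 1 N, g (z n)) atTop
      (𝓝 (∫ d, g d ∂μ))) (g : C(Circ, ℝ)) :
    Tendsto (fun N : ℕ => (N : ℝ)⁻¹ * ∑ n ∈ Finset.Icc 1 N, g (z n)) atTop
      (𝓝 (∫ d, g d ∂μ)) := by
  rw [Metric.tendsto_nhds]
  intro ε hε
  obtain ⟨k, hkD, hk⟩ := hD.exists_dist_lt g (show 0 < ε / 3 by positivity)
  have hpt : ∀ d, |g d - k d| ≤ ε / 3 := fun d =>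
    (ContinuousMap.dist_apply_le_dist (f := g) (g := k) d).trans hk.le
  have hi : ∀ f : C(Circ, ℝ), Integrable f μ := fun f =>
    Integrable.of_bound f.continuous.measurable.aestronglyMeasurable ‖f‖
      (.of_forall fun q => f.norm_coe_le_norm _)
  have h1 : |∫ d, g d ∂μ - ∫ d, k d ∂μ| ≤ ε / 3 := by
    rw [← integral_sub (hi g) (hi k)]
    have := norm_integral_le_of_norm_le_const (μ := μ) (f := fun d => g d - k d)
      (.of_forall hpt)
    simpa using this
  filter_upwards [Metric.tendsto_nhds.1 (h k hkD) (ε / 3) (by positivity)] with N hN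
  have h2 : |(N : ℝ)⁻¹ * ∑ n ∈ Finset.Icc 1 N, g (z n) -
      (N : ℝ)⁻¹ * ∑ n ∈ Finset.Icc 1 N, k (z n)| ≤ ε / 3 := by
    rw [← mul_sub, ← Finset.sum_sub_distrib, abs_mul, abs_of_nonneg (by positivity)]
    calc (N : ℝ)⁻¹ * |∑ n ∈ Finset.Icc 1 N, (g (z n) - k (z n))|
        ≤ (N : ℝ)⁻¹ * ∑ n ∈ Finset.Icc 1 N, ε / 3 := by
          gcongr
          exact (Finset.abs_sum_le_sum_abs _ _).trans (Finset.sum_le_sum fun n _ => hpt _)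
      _ = ((N : ℝ)⁻¹ * N) * (ε / 3) := by simp [mul_assoc]
      -- Only an inequality, since `N = 0` gives `0⁻¹ * 0 = 0`.
      _ ≤ 1 * (ε / 3) := by
          gcongr
          exact inv_mul_le_one
      _ = ε / 3 := one_mul _
  rw [Real.dist_eq] at hN ⊢
  rw [abs_le] at h1 h2
  rw [abs_lt] at hN ⊢
  constructor <;> linarith [h1.1, h1.2, h2.1, h2.2, hN.1, hN.2]

theorem integral_empiricalMeasure (z : ℕ → Circ) (N : ℕ) (g : C(Circ, ℝ)) :
    ∫ d, g d ∂(empiricalMeasure z N : Measure Circ) =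
      (N : ℝ)⁻¹ * ∑ n ∈ Finset.Icc 1 N, g (z n) := by
  rw [empiricalMeasure, FiniteMeasure.toMeasure_smul, FiniteMeasure.toMeasure_sum,
    integral_smul_nnreal_measure, integral_finsetSum_measure]
  · simp [diracMeasure, NNReal.smul_def]
  · intro n _
    exact Integrable.of_bound g.continuous.measurable.aestronglyMeasurable ‖g‖
      (.of_forall fun q => g.norm_coe_le_norm _)

theorem tendsto_empiricalMeasure_iff {z : ℕ → Circ} {μ : FiniteMeasure Circ} :
    Tendsto (empiricalMeasure z) atTop (𝓝 μ) ↔ ∀ g : C(Circ, ℝ),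
      Tendsto (fun N : ℕ => (N : ℝ)⁻¹ * ∑ n ∈ Finset.Icc 1 N, g (z n)) atTop
        (𝓝 (∫ d, g d ∂(μ : Measure Circ))) := by
  rw [FiniteMeasure.tendsto_iff_forall_integral_tendsto]
  constructor
  · intro h g
    simp only [← integral_empiricalMeasure]
    exact h (BoundedContinuousFunction.mkOfCompact g)
  · intro h g
    have := h g.toContinuousMap
    simp only [← integral_empiricalMeasure] at this
    exact this

/-- Test with the norm: its mean `I` is positive as `0` carries no mass, whereas synchronization
with `δ = I / 2` would bound the limit of the averages by `I / 2`. -/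
theorem not_synchronizes_of_tendsto {x y : ℕ → Circ} {μ : Measure Circ} [IsProbabilityMeasure μ]
    (hμ : μ {0} = 0)
    (h : ∀ g : C(Circ, ℝ),
      Tendsto (fun N : ℕ => (N : ℝ)⁻¹ * ∑ n ∈ Finset.Icc 1 N, g (x n - y n)) atTop
        (𝓝 (∫ d, g d ∂μ))) : ¬ Synchronizes x y := by
  intro hsync
  set g : C(Circ, ℝ) := ⟨fun d => ‖d‖, continuous_norm⟩ with hg
  have hi : Integrable g μ :=
    Integrable.of_bound g.continuous.measurable.aestronglyMeasurable ‖g‖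
      (.of_forall fun q => g.norm_coe_le_norm _)
  have hpos : 0 < ∫ d, g d ∂μ := by
    refine (integral_pos_iff_support_of_nonneg (f := g) (fun d => norm_nonneg d) hi).2 ?_
    have hsupp : Function.support g = {0}ᶜ := by
      ext d
      simp [hg]
    rw [hsupp, prob_compl_eq_one_sub (measurableSet_singleton 0), hμ]
    simp
  set I := ∫ d, g d ∂μ with hI
  have hfreq := hsync (I / 2) (by positivity)
  set freq : ℕ → ℝ := fun N =>
    ({n : ℕ | 1 ≤ n ∧ n ≤ N ∧ dist (x n) (y n) < I / 2}.ncard : ℝ) / (N : ℝ) with hfreqdef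
  have hbound : ∀ᶠ N : ℕ in atTop, (N : ℝ)⁻¹ * ∑ n ∈ Finset.Icc 1 N, g (x n - y n) ≤
      I / 2 + ‖g‖ * (1 - freq N) := by
    filter_upwards [eventually_gt_atTop 0] with N hN
    have hN' : (0 : ℝ) < N := by exact_mod_cast hN
    classical
    have hset : {n : ℕ | 1 ≤ n ∧ n ≤ N ∧ dist (x n) (y n) < I / 2} =
        ((Finset.Icc 1 N).filter fun n => dist (x n) (y n) < I / 2 : Finset ℕ) := by
      ext n
      simp [and_assoc]
    have hpt : ∀ n ∈ Finset.Icc 1 N, g (x n - y n) ≤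
        I / 2 + (‖g‖ - ‖g‖ * if dist (x n) (y n) < I / 2 then 1 else 0) := by
      intro n _
      split_ifs with hd
      · rw [dist_eq_norm] at hd
        simpa [hg] using hd.le
      · have := (le_abs_self _).trans (g.norm_coe_le_norm (x n - y n))
        linarith
    have hsum := Finset.sum_le_sum hpt
    rw [Finset.sum_add_distrib, Finset.sum_sub_distrib, ← Finset.mul_sum, Finset.sum_boole] at hsum
    simp only [Finset.sum_const, Nat.card_Icc, add_tsub_cancel_right, nsmul_eq_mul] at hsum
    simp only [hfreqdef]
    rw [hset, Set.ncard_coe_finset, inv_mul_le_iff₀ hN']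
    refine hsum.trans (le_of_eq ?_)
    field_simp
  have hlim : Tendsto (fun N => I / 2 + ‖g‖ * (1 - freq N)) atTop
      (𝓝 (I / 2 + ‖g‖ * (1 - 1))) :=
    ((tendsto_const_nhds.sub hfreq).const_mul _).const_add _
  have := le_of_tendsto_of_tendsto (h g) hlim hbound
  rw [sub_self, mul_zero, add_zero] at this
  linarith

end WeakConvergence

/-- A countable dense set of test functions allows one null set of `w` to serve all `g`. -/
theorem ae_forall_tendsto_average {A : Set Circ} {v : Circ} (hA : MeasurableSet A)
    (hsymm : NoTranslationalSymmetries A) (hint : normalizer A < ∞) (hv : addOrderOf v = 0) :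
    ∀ᵐ p : Circ × Circ, ∀ᵐ w ∂shiftMeasure, ∀ g : C(Circ, ℝ),
      Tendsto (fun N : ℕ => (N : ℝ)⁻¹ * ∑ n ∈ Finset.Icc 1 N,
        g (randomIterate A v w n p.1 - randomIterate A v w n p.2)) atTop
        (𝓝 (∫ d, g d ∂limitMeasure A)) := by
  have := isProbabilityMeasure_limitMeasure hA hint
  obtain ⟨D, hDc, hD⟩ := TopologicalSpace.exists_countable_dense C(Circ, ℝ)
  have h : ∀ᵐ p : Circ × Circ, ∀ g ∈ D, ∀ᵐ w ∂shiftMeasure,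
      Tendsto (fun N : ℕ => (N : ℝ)⁻¹ * ∑ n ∈ Finset.Icc 1 N,
        g (randomIterate A v w n p.1 - randomIterate A v w n p.2)) atTop
        (𝓝 (∫ d, g d ∂limitMeasure A)) :=
    (ae_ball_iff hDc).2 fun g _ => ae_tendsto_average hA hsymm hint hv g
  filter_upwards [h] with p hp
  filter_upwards [(ae_ball_iff hDc).2 hp] with w hw
  exact tendsto_average_of_dense hD hw

end DoubleRotation

theorem theorem4 (A : Set DoubleRotation.Circ) (hA : MeasurableSet A)
    (hsymm : DoubleRotation.NoTranslationalSymmetries A)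
    (hint : ∫⁻ ε : DoubleRotation.Circ, DoubleRotation.invDisplacement A ε < ∞)
    (θ : ℝ) (hθ : Irrational θ) :
    ∃ μ : ProbabilityMeasure DoubleRotation.Circ,
      (μ : Measure DoubleRotation.Circ) = DoubleRotation.limitMeasure A ∧
      (μ : Measure DoubleRotation.Circ) {0} = 0 ∧
      (∀ᵐ p : DoubleRotation.Circ × DoubleRotation.Circ, ∀ᵐ w ∂DoubleRotation.shiftMeasure,
        Tendsto
          (DoubleRotation.empiricalMeasure fun n =>
            DoubleRotation.randomIterate A (θ : DoubleRotation.Circ) w n p.1 -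
              DoubleRotation.randomIterate A (θ : DoubleRotation.Circ) w n p.2)
          atTop (𝓝 μ.toFiniteMeasure)) ∧
      (∀ᵐ p : DoubleRotation.Circ × DoubleRotation.Circ, ∀ᵐ w ∂DoubleRotation.shiftMeasure,
        ¬ DoubleRotation.Synchronizes
          (fun n => DoubleRotation.randomIterate A (θ : DoubleRotation.Circ) w n p.1)
          (fun n => DoubleRotation.randomIterate A (θ : DoubleRotation.Circ) w n p.2)) := by
  have hprob := DoubleRotation.isProbabilityMeasure_limitMeasure hA hint
  have hzero := DoubleRotation.limitMeasure_singleton_zero A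
  have hlim := DoubleRotation.ae_forall_tendsto_average hA hsymm hint
    (DoubleRotation.addOrderOf_coe_of_irrational hθ)
  refine ⟨⟨DoubleRotation.limitMeasure A, hprob⟩, rfl, hzero, ?_, ?_⟩
  · filter_upwards [hlim] with p hp
    filter_upwards [hp] with w hw
    exact DoubleRotation.tendsto_empiricalMeasure_iff.2 hw
  · filter_upwards [hlim] with p hp
    filter_upwards [hp] with w hw
    exact DoubleRotation.not_synchronizes_of_tendsto hzero hw
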